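/- Let $n,N\ge 1$ and let $K\in\operatorname{End}(\mathbb{C}^n)$ be diagonalizable with simple spectrum, i.e. $K$ has $n$ pairwise distinct eigenvalues. Let $\mathcal H=V_1\otimes\cdots\otimes V_N$ with $V_l=\mathbb{C}^n$, let $V_a=\mathbb{C}^n$ be an auxiliary space, and let $R_{a,l}(u)=u\,I+\mathbb P_{a,l}$, where $\mathbb P_{a,l}$ is the permutation operator of $V_a\otimes V_l$ (extended by the identity to $V_a\otimes\mathcal H$). For $\xi=(\xi_1,\dots,\xi_N)\in\mathbb{C}^N$ and $\lambda\in\mathbb{C}$ put $$T^{(K)}(\lambda,\xi)=\operatorname{tr}_{V_a}\bigl(K_a\,R_{a,N}(\lambda-\xi_N)\cdots R_{a,1}(\lambda-\xi_1)\bigr)\in\operatorname{End}(\mathcal H).$$ A function $t:\mathbb{C}\to\mathbb{C}$ is called an eigenvalue of the family $T^{(K)}(\cdot,\xi)$ if there is a nonzero $|t\rangle\in\mathcal H$ (an eigenvector) with $T^{(K)}(\lambda,\xi)|t\rangle=t(\lambda)|t\rangle$ for all $\lambda\in\mathbb{C}$; an eigencovector for $t$ is a nonzero $\langle t|\in\mathcal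 H^*$ with $\langle t|T^{(K)}(\lambda,\xi)=t(\lambda)\langle t|$ for all $\lambda$. Then for almost all $\xi\in\mathbb{C}^N$, namely for all $\xi$ outside the zero set of some nonzero polynomial in $\xi_1,\dots,\xi_N$ (which may depend on $n$, $N$ and $K$), the following hold. 1. Each eigenvalue $t$ of the family $T^{(K)}(\cdot,\xi)$ has an eigenvector $|t\rangle$ and an eigencovector $\langle t|$, each unique up to a scalar factor, and $\langle t|t\rangle\neq 0$. 2. Consequently the family $T^{(K)}(\cdot,\xi)$ is diagonalizable with simple spectrum: $\mathcal H$ has a basis of common eigenvectors of all the operators $T^{(K)}(\lambda,\xi)$, $\lambda\in\mathbb{C}$, whose $n^N$ eigenvalue functions are pairwise distinct. Moreover, for all but finitely many $\lambda\in\mathbb{C}$ the single operator $T^{(K)}(\lambda,\xi)$ is diagonalizable with simple spectrum. -/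

import Mathlib

open scoped Matrix Kronecker

noncomputable section

namespace YangianGln

/-- The elementary basis of the space of states `ℋ = V₁ ⊗ ⋯ ⊗ V_N`, `V_l = ℂⁿ`, is indexed by the
`N`-tuples `s : Fin N → Fin n`, where `s` stands for `e_{s 0} ⊗ ⋯ ⊗ e_{s (N-1)}`. Thus vectors and
covectors of `ℋ` are functions `Sites n N → ℂ` and operators on `ℋ` are square matrices indexed by
`Sites n N`. The elementary basis of `V_a ⊗ ℋ`, with auxiliary space `V_a = ℂⁿ`, is indexed by
`Fin n × Sites n N`. The site numbered `l` in `{1, …, N}` is `l - 1 : Fin N`. -/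
abbrev Sites (n N : ℕ) : Type := Fin N → Fin n

/-- The permutation operator on `ℂⁿ ⊗ ℂⁿ`: it sends `e_k ⊗ e_l` to `e_l ⊗ e_k`. -/
def permOp (n : ℕ) : Matrix (Fin n × Fin n) (Fin n × Fin n) ℂ :=
  Matrix.of fun p q => if p = q.swap then 1 else 0

/-- The rational `gl_n` R-matrix `R(u) = u I + P` on `ℂⁿ ⊗ ℂⁿ`. -/
def rMatrix (n : ℕ) (u : ℂ) : Matrix (Fin n × Fin n) (Fin n × Fin n) ℂ :=
  u • (1 : Matrix (Fin n × Fin n) (Fin n × Fin n) ℂ) + permOp n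

/-- The operator on `V_a ⊗ ℋ` that acts as `A` on `V_a ⊗ V_l` and as the identity on the other
tensor factors. -/
def actAuxSite {n N : ℕ} (l : Fin N) (A : Matrix (Fin n × Fin n) (Fin n × Fin n) ℂ) :
    Matrix (Fin n × Sites n N) (Fin n × Sites n N) ℂ :=
  Matrix.of fun x y =>
    if ∀ k, k ≠ l → x.2 k = y.2 k then A (x.1, x.2 l) (y.1, y.2 l) else 0

/-- The monodromy matrix
`M_a(z) = K_a R_{a,N}(z - ξ_N) ⋯ R_{a,1}(z - ξ_1)`, an operator on `V_a ⊗ ℋ`. -/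
def monodromy {n N : ℕ} (K : Matrix (Fin n) (Fin n) ℂ) (ξ : Fin N → ℂ) (z : ℂ) :
    Matrix (Fin n × Sites n N) (Fin n × Sites n N) ℂ :=
  (K ⊗ₖ (1 : Matrix (Sites n N) (Sites n N) ℂ)) *
    (List.ofFn fun l : Fin N => actAuxSite l (rMatrix n (z - ξ l))).reverse.prod

/-- The transfer matrix `T(z) = tr_{V_a} M_a(z)`, an operator on `ℋ`. -/
def transferMatrix {n N : ℕ} (K : Matrix (Fin n) (Fin n) ℂ) (ξ : Fin N → ℂ) (z : ℂ) :
    Matrix (Sites n N) (Sites n N) ℂ :=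
  Matrix.of fun s t => ∑ i : Fin n, monodromy K ξ z (i, s) (i, t)

/-- `v` is an eigenvector of the one-parameter family `T(z)`, with eigenvalue the function
`t(z)`. -/
def IsEigenvector {m : Type*} [Fintype m] (T : ℂ → Matrix m m ℂ) (t : ℂ → ℂ) (v : m → ℂ) : Prop :=
  v ≠ 0 ∧ ∀ z, T z *ᵥ v = t z • v

/-- `w` is an eigencovector (left eigenvector) of the one-parameter family `T(z)`, with eigenvalue
the function `t(z)`. -/
def IsEigencovector {m : Type*} [Fintype m] (T : ℂ → Matrix m m ℂ) (t : ℂ → ℂ) (w : m → ℂ) :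
    Prop :=
  w ≠ 0 ∧ ∀ z, w ᵥ* T z = t z • w

/-- The function `t(z)` is an eigenvalue of the one-parameter family `T(z)`. -/
def IsEigenvalue {m : Type*} [Fintype m] (T : ℂ → Matrix m m ℂ) (t : ℂ → ℂ) : Prop :=
  ∃ v, IsEigenvector T t v

/-- A single matrix is diagonalizable with simple spectrum: it has a basis of eigenvectors, with
pairwise distinct eigenvalues. -/
def IsDiagSimple {m : Type*} [Fintype m] (A : Matrix m m ℂ) : Prop :=
  ∃ (b : Module.Basis m ℂ (m → ℂ)) (d : m → ℂ),
    Function.Injective d ∧ ∀ i, A *ᵥ b i = d i • b i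

/-- The one-parameter family `T(z)` is diagonalizable with simple spectrum: there is a basis of
vectors that are eigenvectors of all the `T(z)`, with pairwise distinct eigenvalue functions. -/
def IsDiagSimpleFamily {m : Type*} [Fintype m] (T : ℂ → Matrix m m ℂ) : Prop :=
  ∃ (b : Module.Basis m ℂ (m → ℂ)) (t : m → ℂ → ℂ),
    Function.Injective t ∧ ∀ i z, T z *ᵥ b i = t i z • b i

/-- A property holds for almost all `ξ ∈ ℂᴺ`: it holds outside the zero set of some nonzero
polynomial in `ξ_1, …, ξ_N`. -/
def ForAlmostAll {N : ℕ} (P : (Fin N → ℂ) → Prop) : Prop :=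
  ∃ p : MvPolynomial (Fin N) ℂ, p ≠ 0 ∧ ∀ ξ, MvPolynomial.eval ξ p ≠ 0 → P ξ

end YangianGln

end

/-! The Yang–Baxter equation makes all the operators `T(z)` commute. A matrix commuting with one
that has simple spectrum is diagonal in its eigenbasis, so everything about the family follows once
`T(0)` has simple spectrum. That condition on `ξ` is the nonvanishing of a polynomial, the
discriminant of the characteristic polynomial of `T(0)`, so it remains to find one good `ξ`.

Large inhomogeneities `ξ_l = -1/(ε c_l)` supply it. Since `tr_a (K_a P_{a,l}) = K_l`, up to a
nonzero scalar `T(0)` equals `tr K + ε ∑ c_l K_l + O(ε²)`. On tensor products of eigenvectors of `K`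
the sum `∑ c_l K_l` has the eigenvalues `∑ c_l d(σ l)`, pairwise distinct for suitable `c`;
simplicity of the spectrum survives a small perturbation (`exists_isDiagSimple_transferMatrix`).

Finally `T(z)` depends only on the differences `z - ξ_l`, so along `ξ - z(1, …, 1)` the same
discriminant is a nonzero polynomial in `z`, with finitely many zeros. -/

noncomputable section

namespace YangianGln

/-! ### Simple spectrum and the discriminant -/

section LinearAlgebra

variable {m : Type*} [Fintype m]

/-- Eigenvectors for pairwise distinct eigenvalues, as many as the dimension, form a basis. -/
lemma isDiagSimple_of_eigenvectors {A : Matrix m m ℂ} {v : m → m → ℂ}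
    {d : m → ℂ} (hd : Function.Injective d) (hv : ∀ i, v i ≠ 0)
    (h : ∀ i, A *ᵥ v i = d i • v i) : IsDiagSimple A := by
  classical
  have hli : LinearIndependent ℂ v :=
    Module.End.eigenvectors_linearIndependent' (Matrix.toLin' A) d hd v fun i =>
      ⟨by simpa [Module.End.mem_eigenspace_iff] using h i, hv i⟩
  rcases isEmpty_or_nonempty m with hm | hm
  · exact ⟨Pi.basisFun ℂ m, d, hd, fun i => isEmptyElim i⟩
  · refine ⟨basisOfLinearIndependentOfCardEqFinrank hli (by simp), d, hd, fun i => ?_⟩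
    simpa using h i

lemma IsDiagSimple.smul_add {A B : Matrix m m ℂ} [DecidableEq m] (hA : IsDiagSimple A) {a : ℂ}
    (ha : a ≠ 0) (c : ℂ) (hB : B = a • A + c • (1 : Matrix m m ℂ)) : IsDiagSimple B := by
  obtain ⟨b, d, hd, h⟩ := hA
  refine ⟨b, fun i => a * d i + c, fun i j hij => hd ?_, fun i => ?_⟩
  · simpa [ha] using hij
  · rw [hB, Matrix.add_mulVec, Matrix.smul_mulVec, Matrix.smul_mulVec, h, Matrix.one_mulVec,
      add_smul, mul_smul]

variable [DecidableEq m]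

/-- Distinct eigenvalues, as many as the dimension, already exhaust the roots of the characteristic
polynomial with multiplicity, so there is no room for a double root. -/
lemma isDiagSimple_iff_separable (A : Matrix m m ℂ) : IsDiagSimple A ↔ A.charpoly.Separable := by
  have hroot : ∀ x : ℂ, A.charpoly.IsRoot x ↔ Module.End.HasEigenvalue (Matrix.toLin' A) x := fun x => by
    rw [Module.End.hasEigenvalue_iff_isRoot_charpoly, Matrix.charpoly_toLin']
  have hmon := A.charpoly_monic
  have hsplit := IsAlgClosed.splits A.charpoly
  constructor
  · rintro ⟨b, d, hd, h⟩
    have hmem : ∀ i, d i ∈ A.charpoly.roots := fun i => by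
      rw [Polynomial.mem_roots hmon.ne_zero, hroot]
      exact Module.End.hasEigenvalue_of_hasEigenvector (x := b i)
        ⟨by simpa [Module.End.mem_eigenspace_iff] using h i, b.ne_zero i⟩
    have hle : (Finset.univ.map ⟨d, hd⟩).val ≤ A.charpoly.roots := by
      rw [Multiset.le_iff_subset (Finset.nodup _)]
      intro x hx
      obtain ⟨i, -, rfl⟩ := Finset.mem_map.1 (Finset.mem_def.2 hx)
      exact hmem i
    have hcard : A.charpoly.roots.card ≤ (Finset.univ.map ⟨d, hd⟩).val.card := by
      refine (Polynomial.card_roots' _).trans ?_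
      simp [Matrix.charpoly_natDegree_eq_dim]
    rw [← Polynomial.nodup_roots_iff_of_splits hmon.ne_zero hsplit,
      ← Multiset.eq_of_le_of_card_le hle hcard]
    exact Finset.nodup _
  · intro hsep
    have hnd := Polynomial.nodup_roots hsep
    have hcard : A.charpoly.roots.toFinset.card = Fintype.card m := by
      rw [Multiset.toFinset_card_of_nodup hnd, ← hsplit.natDegree_eq_card_roots,
        Matrix.charpoly_natDegree_eq_dim]
    let e : m ≃ A.charpoly.roots.toFinset := Fintype.equivOfCardEq (by simpa using hcard.symm)
    have hev : ∀ i, ∃ v, Module.End.HasEigenvector (Matrix.toLin' A) (e i : ℂ) v := fun i => by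
      refine ((hroot _).1 ?_).exists_hasEigenvector
      have := (e i).2
      rw [Multiset.mem_toFinset, Polynomial.mem_roots hmon.ne_zero] at this
      exact this
    choose v hv using hev
    refine isDiagSimple_of_eigenvectors (v := v) (d := fun i => (e i : ℂ))
      (Subtype.val_injective.comp e.injective) (fun i => (hv i).2) fun i => ?_
    simpa using (hv i).apply_eq_smul

/-- The resultant of the characteristic polynomial and its derivative: up to sign, the
discriminant of the characteristic polynomial. -/
def specDisc {R : Type*} [CommRing R] (A : Matrix m m R) : R :=
  Polynomial.resultant A.charpoly A.charpoly.derivative (Fintype.card m) (Fintype.card m - 1)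

/-- The degrees fed to the resultant are fixed by the size of the matrix, so `specDisc` is one
universal polynomial in the entries and specializes along any ring map. -/
lemma specDisc_map {R S : Type*} [CommRing R] [CommRing S] (f : R →+* S) (A : Matrix m m R) :
    specDisc (A.map f) = f (specDisc A) := by
  rw [specDisc, Matrix.charpoly_map, Polynomial.derivative_map, Polynomial.resultant_map_map]
  rfl

lemma specDisc_ne_zero_iff (A : Matrix m m ℂ) : specDisc A ≠ 0 ↔ IsDiagSimple A := by
  have h1 : A.charpoly.natDegree = Fintype.card m := A.charpoly_natDegree_eq_dim
  have h2 : A.charpoly.derivative.natDegree = Fintype.card m - 1 := by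
    rw [Polynomial.natDegree_derivative, h1]
  have h3 : specDisc A = Polynomial.resultant A.charpoly A.charpoly.derivative := by
    rw [specDisc, h1, h2]
  rw [isDiagSimple_iff_separable, h3, Ne, Polynomial.resultant_eq_zero_iff, Polynomial.Separable]
  simp [A.charpoly_monic.ne_zero]

lemma continuous_specDisc : Continuous fun A : Matrix m m ℂ => specDisc A := by
  have h : (fun A : Matrix m m ℂ => specDisc A) = fun A =>
      MvPolynomial.eval (fun ij : m × m => A ij.1 ij.2)
        (specDisc (Matrix.mvPolynomialX m m ℂ)) := by
    funext A
    rw [← specDisc_map]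
    congr 1
    ext i j
    simp [Matrix.mvPolynomialX]
  rw [h]
  exact (MvPolynomial.continuous_eval _).comp
    (continuous_pi fun ij => (continuous_apply ij.2).comp (continuous_apply ij.1))

end LinearAlgebra

/-! ### Commuting families with a simple member -/

section Family

variable {m : Type*} [Fintype m]

/-- The eigenspaces of `T z₀` are lines, and each `T z` preserves them. The eigenvalue functions
already differ at `z₀`. -/
lemma IsDiagSimpleFamily.of_commute {T : ℂ → Matrix m m ℂ} {z₀ : ℂ} (h₀ : IsDiagSimple (T z₀))
    (hc : ∀ z, Commute (T z₀) (T z)) : IsDiagSimpleFamily T := by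
  obtain ⟨b, d, hd, h⟩ := h₀
  have key : ∀ i z, ∃ c : ℂ, T z *ᵥ b i = c • b i := by
    intro i z
    have h1 : T z₀ *ᵥ (T z *ᵥ b i) = d i • (T z *ᵥ b i) := by
      rw [Matrix.mulVec_mulVec, (hc z).eq, ← Matrix.mulVec_mulVec, h, Matrix.mulVec_smul]
    set y := T z *ᵥ b i with hy
    have h2 : ∀ j, b.repr y j * d j = d i * b.repr y j := by
      intro j
      have h3 : T z₀ *ᵥ y = ∑ j, (b.repr y j * d j) • b j := by
        conv_lhs => rw [← b.sum_repr y]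
        rw [Matrix.mulVec_sum]
        exact Finset.sum_congr rfl fun j _ => by rw [Matrix.mulVec_smul, h, smul_smul]
      have h4 := congrArg (fun x => b.repr x j) (h3.symm.trans h1)
      simpa only [b.repr_sum_self, map_smul, Finsupp.smul_apply, smul_eq_mul] using h4
    refine ⟨b.repr y i, ?_⟩
    conv_lhs => rw [← b.sum_repr y]
    refine Finset.sum_eq_single i (fun j _ hj => ?_) (by simp)
    have h5 : b.repr y j * (d j - d i) = 0 := by linear_combination h2 j
    rcases mul_eq_zero.1 h5 with h6 | h6
    · rw [h6, zero_smul]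
    · exact absurd (hd (sub_eq_zero.1 h6)) hj
  choose t ht using key
  refine ⟨b, t, fun i j hij => hd ?_, ht⟩
  have aux : ∀ i, t i z₀ = d i := fun i =>
    smul_left_injective ℂ (b.ne_zero i) ((ht i z₀).symm.trans (h i))
  rw [← aux, ← aux, hij]

/-- In the eigenbasis, eigenvectors are multiples of basis vectors and eigencovectors are multiples
of dual basis vectors; those with the same eigenvalue share an index and pair to a nonzero number.
-/
lemma IsDiagSimpleFamily.eigenvalue {T : ℂ → Matrix m m ℂ} (hT : IsDiagSimpleFamily T) {t : ℂ → ℂ}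
    (ht : IsEigenvalue T t) :
    (∃ v, IsEigenvector T t v ∧ ∀ v', IsEigenvector T t v' → ∃ c : ℂ, v' = c • v) ∧
    (∃ w, IsEigencovector T t w ∧ ∀ w', IsEigencovector T t w' → ∃ c : ℂ, w' = c • w) ∧
    ∀ v w, IsEigenvector T t v → IsEigencovector T t w → w ⬝ᵥ v ≠ 0 := by
  classical
  obtain ⟨b, τ, hτ, h⟩ := hT
  have hrepr : ∀ y z j, b.repr (T z *ᵥ y) j = τ j z * b.repr y j := by
    intro y z j
    have h3 : T z *ᵥ y = ∑ j, (τ j z * b.repr y j) • b j := by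
      conv_lhs => rw [← b.sum_repr y]
      rw [Matrix.mulVec_sum]
      exact Finset.sum_congr rfl fun j _ => by
        rw [Matrix.mulVec_smul, h, smul_smul, mul_comm]
    rw [h3, b.repr_sum_self]
  have hvec : ∀ s v, IsEigenvector T s v → ∃ i, s = τ i ∧ b.repr v i ≠ 0 ∧ v = b.repr v i • b i := by
    rintro s v ⟨hv0, hv⟩
    have hj : ∀ j, b.repr v j ≠ 0 → s = τ j := fun j hj => by
      funext z
      have := hrepr v z j
      rw [hv z, map_smul, Finsupp.smul_apply, smul_eq_mul] at this
      exact mul_right_cancel₀ hj this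
    obtain ⟨i, hi⟩ : ∃ i, b.repr v i ≠ 0 := by
      by_contra! hall
      exact hv0 (b.repr.map_eq_zero_iff.1 (Finsupp.ext hall))
    refine ⟨i, hj i hi, hi, ?_⟩
    conv_lhs => rw [← b.sum_repr v]
    refine Finset.sum_eq_single i (fun j _ hji => ?_) (by simp)
    by_cases h0 : b.repr v j = 0
    · rw [h0, zero_smul]
    · exact absurd (hτ ((hj j h0).symm.trans (hj i hi))) hji
  obtain ⟨v₀, hv₀⟩ := ht
  obtain ⟨i, rfl, -, -⟩ := hvec t v₀ hv₀
  have hbi : IsEigenvector T (τ i) (b i) := ⟨b.ne_zero i, h i⟩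
  have hvec' : ∀ v, IsEigenvector T (τ i) v → ∃ c : ℂ, c ≠ 0 ∧ v = c • b i := fun v hv => by
    obtain ⟨j, hj, hne, he⟩ := hvec _ v hv
    obtain rfl := hτ hj
    exact ⟨_, hne, he⟩
  -- a covector is determined by its pairings with the basis
  have hext : ∀ x y : m → ℂ, (∀ j, x ⬝ᵥ b j = y ⬝ᵥ b j) → x = y := fun x y hxy => by
    refine dotProduct_eq _ _ fun u => ?_
    rw [← b.sum_repr u, dotProduct_sum, dotProduct_sum]
    exact Finset.sum_congr rfl fun j _ => by rw [dotProduct_smul, dotProduct_smul, hxy]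
  -- The `i`-th dual basis vector, in standard coordinates.
  let w₀ : m → ℂ := fun k => b.repr (Pi.single k 1) i
  have hw₀ : ∀ u, w₀ ⬝ᵥ u = b.repr u i := fun u => by
    conv_rhs => rw [pi_eq_sum_univ' u]
    simp only [map_sum, Finsupp.finsetSum_apply, map_smul, Finsupp.smul_apply, smul_eq_mul]
    exact Finset.sum_congr rfl fun k _ => by
      rw [mul_comm]
  have hw₀e : IsEigencovector T (τ i) w₀ := by
    refine ⟨fun h0 => ?_, fun z => hext _ _ fun j => ?_⟩
    · have := hw₀ (b i)
      simp [h0] at this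
    · rw [← Matrix.dotProduct_mulVec, hw₀, hrepr, smul_dotProduct, hw₀]
      by_cases hij : i = j
      · subst hij; simp
      · simp [Ne.symm hij]
  have hcov : ∀ w, IsEigencovector T (τ i) w → ∀ j, j ≠ i → w ⬝ᵥ b j = 0 := by
    rintro w ⟨-, hw⟩ j hj
    by_contra hne
    refine hj (hτ (funext fun z => ?_))
    have h1 : w ⬝ᵥ (T z *ᵥ b j) = (w ᵥ* T z) ⬝ᵥ b j := Matrix.dotProduct_mulVec _ _ _
    rw [h, hw, dotProduct_smul, smul_dotProduct, smul_eq_mul, smul_eq_mul] at h1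
    exact mul_right_cancel₀ hne h1
  have hcov' : ∀ w, IsEigencovector T (τ i) w → w = (w ⬝ᵥ b i) • w₀ := fun w hw =>
    hext _ _ fun j => by
      rw [smul_dotProduct, hw₀]
      by_cases hij : j = i
      · subst hij; simp
      · simp [hcov w hw j hij, hij]
  refine ⟨⟨b i, hbi, fun v' hv' => ?_⟩, ⟨w₀, hw₀e, fun w' hw' => ⟨_, hcov' w' hw'⟩⟩, ?_⟩
  · obtain ⟨c, -, hc⟩ := hvec' v' hv'
    exact ⟨c, hc⟩
  · intro v w hv hw h0
    obtain ⟨c, hc, rfl⟩ := hvec' v hv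
    rw [dotProduct_smul, smul_eq_mul, mul_eq_zero] at h0
    refine hw.1 ?_
    rw [hcov' w hw, h0.resolve_left hc, zero_smul]

end Family

/-! ### The RTT relation and commuting traces -/

section RTT

variable {ι B : Type*} [Ring B] [Algebra ℂ B]

/-- The relation `R(u) X_a Y_b = Y_b X_a R(u)` between operator-valued matrices `X` and `Y`,
written in components. -/
def RTTRel (u : ℂ) (X Y : Matrix ι ι B) : Prop :=
  ∀ i j k l, u • (X i j * Y k l) + X k j * Y i l = u • (Y k l * X i j) + Y k j * X i l

/-- The R-matrix is carried first past `X₁ Y₁`, then past `X₂ Y₂`; the commutation hypotheses allow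
this regrouping. -/
lemma RTTRel.mul [Fintype ι] {u : ℂ} {X₁ Y₁ X₂ Y₂ : Matrix ι ι B} (h₁ : RTTRel u X₁ Y₁) (h₂ : RTTRel u X₂ Y₂)
    (hXY : ∀ i j k l, Commute (Y₁ i j) (X₂ k l)) (hYX : ∀ i j k l, Commute (X₁ i j) (Y₂ k l)) :
    RTTRel u (X₁ * X₂) (Y₁ * Y₂) := by
  intro i j k l
  have e1 : ∀ p q, X₁ i p * X₂ p j * (Y₁ k q * Y₂ q l) = X₁ i p * Y₁ k q * (X₂ p j * Y₂ q l) :=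
    fun p q => by simp only [mul_assoc, (hXY k q p j).symm.left_comm]
  have e2 : ∀ p q, X₁ k p * X₂ p j * (Y₁ i q * Y₂ q l) = X₁ k p * Y₁ i q * (X₂ p j * Y₂ q l) :=
    fun p q => by simp only [mul_assoc, (hXY i q p j).symm.left_comm]
  have e3 : ∀ p q, Y₁ k q * Y₂ q l * (X₁ i p * X₂ p j) = Y₁ k q * X₁ i p * (Y₂ q l * X₂ p j) :=
    fun p q => by simp only [mul_assoc, (hYX i p q l).symm.left_comm]
  have e4 : ∀ p q, Y₁ k q * Y₂ q j * (X₁ i p * X₂ p l) = Y₁ k q * X₁ i p * (Y₂ q j * X₂ p l) :=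
    fun p q => by simp only [mul_assoc, (hYX i p q j).symm.left_comm]
  have s1 : ∑ p, ∑ q, (u • (X₁ i p * Y₁ k q) + X₁ k p * Y₁ i q) * (X₂ p j * Y₂ q l) =
      ∑ p, ∑ q, (u • (Y₁ k q * X₁ i p) + Y₁ k p * X₁ i q) * (X₂ p j * Y₂ q l) :=
    Finset.sum_congr rfl fun p _ => Finset.sum_congr rfl fun q _ => by rw [h₁ i p k q]
  have s2 : ∑ p, ∑ q, Y₁ k q * X₁ i p * (u • (X₂ p j * Y₂ q l) + X₂ q j * Y₂ p l) =
      ∑ p, ∑ q, Y₁ k q * X₁ i p * (u • (Y₂ q l * X₂ p j) + Y₂ q j * X₂ p l) :=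
    Finset.sum_congr rfl fun p _ => Finset.sum_congr rfl fun q _ => by rw [h₂ p j q l]
  have s3 : ∑ p, ∑ q, Y₁ k p * X₁ i q * (X₂ p j * Y₂ q l) =
      ∑ p, ∑ q, Y₁ k q * X₁ i p * (X₂ q j * Y₂ p l) := Finset.sum_comm
  simp only [add_mul, mul_add, Finset.sum_add_distrib, smul_mul_assoc, mul_smul_comm,
    ← Finset.smul_sum] at s1 s2
  simp only [Matrix.mul_apply, Finset.sum_mul_sum, e1, e2, e3, e4]
  rw [s1, s3, s2]
  congr 1
  · congr 1
    rw [Finset.sum_comm]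
  · rw [Finset.sum_comm]

/-- Tracing the relation directly, and again after a permutation, gives `u (S - S') = U' - U` and `S
- S' = u (U' - U)`. Hence `(1 - u²)(S - S') = 0`. The excluded values of `u` are those where `R(u)`
need not be invertible. -/
lemma RTTRel.commute_trace [Fintype ι] {u : ℂ} (hu : u ^ 2 ≠ 1) {X Y : Matrix ι ι B} (h : RTTRel u X Y) :
    Commute X.trace Y.trace := by
  have s1 := Finset.sum_congr (rfl : (Finset.univ : Finset ι) = _) fun i _ =>
    Finset.sum_congr (rfl : (Finset.univ : Finset ι) = _) fun k _ => h i i k k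
  have s2 := Finset.sum_congr (rfl : (Finset.univ : Finset ι) = _) fun i _ =>
    Finset.sum_congr (rfl : (Finset.univ : Finset ι) = _) fun k _ => h i k k i
  simp only [Finset.sum_add_distrib, ← Finset.smul_sum] at s1 s2
  have hS : X.trace * Y.trace = ∑ i, ∑ k, X i i * Y k k := by
    simp only [Matrix.trace, Matrix.diag, Finset.sum_mul_sum]
  have hS' : Y.trace * X.trace = ∑ i, ∑ k, Y k k * X i i := by
    rw [Finset.sum_comm]
    simp only [Matrix.trace, Matrix.diag, Finset.sum_mul_sum]
  have c1 : ∑ i, ∑ k, X k i * Y i k = ∑ i, ∑ k, X i k * Y k i := Finset.sum_comm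
  have c2 : ∑ i, ∑ k, X k k * Y i i = ∑ i, ∑ k, X i i * Y k k := Finset.sum_comm
  rw [c1, ← hS, ← hS'] at s1
  rw [c2, ← hS, ← hS'] at s2
  set S := X.trace * Y.trace
  set S' := Y.trace * X.trace
  set U := ∑ i, ∑ k, X i k * Y k i
  set U' := ∑ i, ∑ k, Y k i * X i k
  have hk : (1 - u ^ 2) • (S - S') = 0 := by
    have t1 : u • (S - S') = U' - U := by
      rw [smul_sub, sub_eq_sub_iff_add_eq_add, s1, add_comm]
    have t2 : S - S' = u • (U' - U) := by
      rw [smul_sub, sub_eq_sub_iff_add_eq_add, add_comm, s2]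
    rw [sub_smul, one_smul, pow_two, mul_smul, t1, ← t2, sub_self]
  exact sub_eq_zero.1 ((smul_eq_zero.1 hk).resolve_left (sub_ne_zero.2 hu.symm))

lemma rttRel_algebraMap (u : ℂ) (K : Matrix ι ι ℂ) :
    RTTRel u (K.map (algebraMap ℂ B)) (K.map (algebraMap ℂ B)) := by
  intro i j k l
  simp only [Matrix.map_apply, ← map_mul, mul_comm]

lemma commute_map_algebraMap (K : Matrix ι ι ℂ) (i j : ι) (b : B) :
    Commute (K.map (algebraMap ℂ B) i j) b :=
  Algebra.commutes (K i j) b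

end RTT

/-! ### The monodromy matrix and commuting transfer matrices -/

section Sites

variable {n N : ℕ}

/-- The operator on `ℋ` acting as `A` on the site `l` and as the identity on the other sites. -/
def siteOp (l : Fin N) : Matrix (Fin n) (Fin n) ℂ →ₗ[ℂ] Matrix (Sites n N) (Sites n N) ℂ where
  toFun A := Matrix.of fun s t => if ∀ k, k ≠ l → s k = t k then A (s l) (t l) else 0
  map_add' A B := by
    ext s t
    simp only [Matrix.of_apply, Matrix.add_apply]
    split_ifs <;> simp
  map_smul' c A := by
    ext s t
    simp

lemma siteOp_apply (l : Fin N) (A : Matrix (Fin n) (Fin n) ℂ) (s t : Sites n N) :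
    siteOp l A s t = if ∀ k, k ≠ l → s k = t k then A (s l) (t l) else 0 := rfl

lemma siteOp_mulVec (l : Fin N) (A : Matrix (Fin n) (Fin n) ℂ) (v : Sites n N → ℂ)
    (s : Sites n N) : (siteOp l A *ᵥ v) s = ∑ a, A (s l) a * v (Function.update s l a) := by
  have hinj : Function.Injective fun a => Function.update s l a := Function.update_injective s l
  rw [Matrix.mulVec, dotProduct, ← Finset.sum_subset (Finset.subset_univ
    (Finset.univ.map ⟨fun a => Function.update s l a, hinj⟩)), Finset.sum_map]
  · refine Finset.sum_congr rfl fun a _ => ?_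
    have : ∀ k, k ≠ l → s k = Function.update s l a k := fun k hk => by
      rw [Function.update_of_ne hk]
    simp only [siteOp_apply, Function.Embedding.coeFn_mk, Function.update_self, if_pos this]
  · intro t _ ht
    rw [siteOp_apply, if_neg, zero_mul]
    refine fun h => ht (Finset.mem_map.2 ⟨t l, Finset.mem_univ _, funext fun k => ?_⟩)
    by_cases hk : k = l
    · subst hk; simp
    · simp [hk, h k hk]

lemma siteOp_one (l : Fin N) : siteOp l (1 : Matrix (Fin n) (Fin n) ℂ) = 1 := by
  refine Matrix.ext_of_mulVec_single fun t => ?_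
  funext s
  simp [siteOp_mulVec, Matrix.one_apply]
  simp [Pi.single_apply]

lemma siteOp_mul (l : Fin N) (A B : Matrix (Fin n) (Fin n) ℂ) :
    siteOp l (A * B) = siteOp l A * siteOp l B := by
  refine Matrix.ext_of_mulVec_single fun t => ?_
  funext s
  rw [← Matrix.mulVec_mulVec]
  simp only [siteOp_mulVec, Matrix.mul_apply, Function.update_self, Function.update_idem,
    Finset.sum_mul, Finset.mul_sum, mul_assoc]
  exact Finset.sum_comm

lemma siteOp_commute {l l' : Fin N} (h : l ≠ l') (A B : Matrix (Fin n) (Fin n) ℂ) :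
    Commute (siteOp l A) (siteOp l' B) := by
  refine Matrix.ext_of_mulVec_single fun t => ?_
  funext s
  rw [← Matrix.mulVec_mulVec, ← Matrix.mulVec_mulVec]
  simp only [siteOp_mulVec, Function.update_of_ne h, Function.update_of_ne h.symm,
    Finset.mul_sum]
  rw [Finset.sum_comm]
  refine Finset.sum_congr rfl fun a _ => Finset.sum_congr rfl fun b _ => ?_
  rw [Function.update_comm h, mul_left_comm]

/-- The permutation operator of `V_a ⊗ V_l` as an operator-valued matrix. -/
def laxPerm (l : Fin N) : Matrix (Fin n) (Fin n) (Matrix (Sites n N) (Sites n N) ℂ) :=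
  Matrix.of fun i j => siteOp l (Matrix.single j i 1)

/-- The matrix `x + P_{a,l}` as an operator-valued matrix. -/
def lax (l : Fin N) (x : ℂ) : Matrix (Fin n) (Fin n) (Matrix (Sites n N) (Sites n N) ℂ) :=
  x • 1 + laxPerm l

lemma lax_apply (l : Fin N) (x : ℂ) (i j : Fin n) :
    lax l x i j = siteOp l (Matrix.single j i 1 + if i = j then x • 1 else 0) := by
  rw [map_add, lax, Matrix.add_apply, add_comm]
  congr 1
  by_cases h : i = j
  · subst h
    simp [siteOp_one]
  · simp [h]

/-- All entries act on the same site, so the relation pulls back through `siteOp` to an identity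
between matrix units: the Yang–Baxter equation in components. -/
lemma lax_rttRel (l : Fin N) (x y : ℂ) : RTTRel (x - y) (lax (n := n) l x) (lax l y) := by
  intro i j k p
  simp only [lax_apply, ← siteOp_mul, ← map_smul, ← map_add]
  congr 1
  simp only [add_mul, mul_add, smul_add]
  ext a b
  by_cases hij : i = j <;> by_cases hkp : k = p <;> by_cases hkj : k = j <;>
    by_cases hip : i = p <;>
    simp_all [Matrix.single_mul_single_of_ne, Matrix.single_apply, eq_comm] <;>
    (try split_ifs) <;> ring

lemma lax_commute {l l' : Fin N} (h : l ≠ l') (x y : ℂ) (i j k p : Fin n) :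
    Commute (lax l x i j) (lax l' y k p) := by
  rw [lax_apply, lax_apply]
  exact siteOp_commute h _ _

lemma commute_prod_lax {l : Fin N} (x : ℂ) (f : Fin N → ℂ) {L : List (Fin N)} (h : l ∉ L)
    (i j k p : Fin n) : Commute (lax l x i j) ((L.map fun a => lax a (f a)).prod k p) := by
  induction L generalizing k p with
  | nil =>
    by_cases hkp : k = p
    · subst hkp; simp
    · simp [hkp]
  | cons a L ih =>
    rw [List.mem_cons, not_or] at h
    rw [List.map_cons, List.prod_cons, Matrix.mul_apply]
    exact Commute.sum_right _ _ _ fun q _ => (lax_commute h.1 _ _ _ _ _ _).mul_right (ih h.2 _ _)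

/-- The inhomogeneities cancel in `f a - g a`, so all sites share one `u`; distinct sites commute,
so `RTTRel.mul` applies. -/
lemma prod_lax_rttRel (f g : Fin N → ℂ) (u : ℂ) (hfg : ∀ a, f a - g a = u) {L : List (Fin N)}
    (hL : L.Nodup) : RTTRel u (L.map fun a => lax (n := n) a (f a)).prod
      (L.map fun a => lax a (g a)).prod := by
  induction L with
  | nil =>
    have := rttRel_algebraMap (B := Matrix (Sites n N) (Sites n N) ℂ) u
      (1 : Matrix (Fin n) (Fin n) ℂ)
    rw [Matrix.map_one _ (map_zero _) (map_one _)] at this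
    simpa using this
  | cons a L ih =>
    rw [List.nodup_cons] at hL
    simp only [List.map_cons, List.prod_cons]
    refine RTTRel.mul ?_ (ih hL.2) (fun i j k p => commute_prod_lax _ _ hL.1 _ _ _ _)
      (fun i j k p => commute_prod_lax _ _ hL.1 _ _ _ _)
    rw [← hfg a]
    exact lax_rttRel a _ _

/-- Operators on `V_a ⊗ ℋ` are viewed as matrices over `End ℋ`, which makes the partial trace an
ordinary matrix trace. -/
lemma compRingEquiv_symm_actAuxSite (l : Fin N) (x : ℂ) :
    (Matrix.compRingEquiv (Fin n) (Sites n N) ℂ).symm (actAuxSite l (rMatrix n x)) = lax l x := by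
  ext i j s t
  rw [lax_apply, siteOp_apply]
  change (if _ then _ else _) = _
  refine if_congr Iff.rfl ?_ rfl
  change rMatrix n x (i, s l) (j, t l) = _
  have h1 : (i, s l) = ((j, t l) : Fin n × Fin n).swap ↔ j = s l ∧ i = t l := by
    simp only [Prod.ext_iff, Prod.swap]
    tauto
  rw [rMatrix, permOp, Matrix.add_apply, Matrix.add_apply, Matrix.of_apply, Matrix.single_apply,
    Matrix.smul_apply, Matrix.one_apply, add_comm, if_congr h1 rfl rfl]
  congr 1
  by_cases hij : i = j
  · subst hij
    simp [Matrix.one_apply]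
  · simp [hij]

/-- The transfer matrix is the trace of a product of operator-valued matrices. -/
lemma transferMatrix_eq_trace (K : Matrix (Fin n) (Fin n) ℂ) (ξ : Fin N → ℂ) (z : ℂ) :
    transferMatrix K ξ z = (K.map (algebraMap ℂ (Matrix (Sites n N) (Sites n N) ℂ)) *
      ((List.finRange N).reverse.map fun l => lax l (z - ξ l)).prod).trace := by
  have h1 : (Matrix.compRingEquiv (Fin n) (Sites n N) ℂ).symm (monodromy K ξ z) =
      K.map (algebraMap ℂ (Matrix (Sites n N) (Sites n N) ℂ)) *
        ((List.finRange N).reverse.map fun l => lax l (z - ξ l)).prod := by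
    rw [monodromy, map_mul, map_list_prod, List.ofFn_eq_map, ← List.map_reverse, List.map_map]
    congr 1
    · ext i j s t
      simp [Matrix.kroneckerMap_apply, Matrix.algebraMap_eq_diagonal, Matrix.diagonal_apply,
        Matrix.one_apply]
    · congr 2
      funext l
      exact compRingEquiv_symm_actAuxSite l _
  rw [← h1]
  ext s t
  simp [transferMatrix, Matrix.trace, Matrix.sum_apply]

lemma transferMatrix_commute_of_ne (K : Matrix (Fin n) (Fin n) ℂ) (ξ : Fin N → ℂ) {z w : ℂ}
    (h : (z - w) ^ 2 ≠ 1) : Commute (transferMatrix K ξ z) (transferMatrix K ξ w) := by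
  rw [transferMatrix_eq_trace, transferMatrix_eq_trace]
  have hL := prod_lax_rttRel (n := n) (fun l => z - ξ l) (fun l => w - ξ l) (z - w)
    (fun _ => sub_sub_sub_cancel_right _ _ _) (List.nodup_reverse.2 (List.nodup_finRange N))
  exact ((rttRel_algebraMap (z - w) K).mul hL (fun _ _ _ _ => commute_map_algebraMap K _ _ _)
    fun _ _ _ _ => commute_map_algebraMap K _ _ _).commute_trace h

lemma continuous_transferMatrix (K : Matrix (Fin n) (Fin n) ℂ) (ξ : Fin N → ℂ) :
    Continuous fun z => transferMatrix K ξ z := by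
  simp only [transferMatrix_eq_trace]
  have h : ∀ l : Fin N, Continuous fun z => lax (n := n) l (z - ξ l) := fun l =>
    ((continuous_id.sub continuous_const).smul continuous_const).add continuous_const
  have hp : Continuous fun z =>
      ((List.finRange N).reverse.map fun l => lax (n := n) l (z - ξ l)).prod :=
    continuous_list_prod _ fun l _ => h l
  have hm : Continuous fun z => K.map (algebraMap ℂ (Matrix (Sites n N) (Sites n N) ℂ)) *
      ((List.finRange N).reverse.map fun l => lax (n := n) l (z - ξ l)).prod :=
    continuous_const.mul hp
  exact hm.matrix_trace

/-- The exceptional points `w = z ± 1` are removed by continuity. -/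
lemma transferMatrix_commute (K : Matrix (Fin n) (Fin n) ℂ) (ξ : Fin N → ℂ) (z w : ℂ) :
    Commute (transferMatrix K ξ z) (transferMatrix K ξ w) := by
  have hfin : {w : ℂ | (z - w) ^ 2 = 1}.Finite := by
    refine Set.Finite.subset (Set.toFinite {z - 1, z + 1}) fun w hw => ?_
    rcases sq_eq_one_iff.1 hw with h | h
    · left; linear_combination -h
    · right; simp; linear_combination -h
  have hcont := continuous_transferMatrix K ξ
  have hd : Dense {w : ℂ | (z - w) ^ 2 = 1}ᶜ := hfin.countable.dense_compl ℂ
  have := Continuous.ext_on hd (continuous_const.mul hcont) (hcont.mul continuous_const)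
    fun w hw => (transferMatrix_commute_of_ne K ξ hw).eq
  exact congrFun this w

end Sites

/-! ### A point with simple spectrum -/

section Generic

variable {n N : ℕ}

/-- The tensor product `b_{σ 1} ⊗ ⋯ ⊗ b_{σ N}`. -/
def tensorVec (b : Fin n → Fin n → ℂ) (σ : Sites n N) : Sites n N → ℂ :=
  fun t => ∏ k, b (σ k) (t k)

lemma siteOp_mulVec_tensorVec {K : Matrix (Fin n) (Fin n) ℂ} {b : Fin n → Fin n → ℂ}
    {d : Fin n → ℂ} (h : ∀ i, K *ᵥ b i = d i • b i) (l : Fin N) (σ : Sites n N) :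
    siteOp l K *ᵥ tensorVec b σ = d (σ l) • tensorVec b σ := by
  funext s
  have hup : ∀ a, tensorVec b σ (Function.update s l a) =
      b (σ l) a * ∏ k ∈ {l}ᶜ, b (σ k) (s k) := fun a => by
    rw [tensorVec, Fintype.prod_eq_mul_prod_compl l, Function.update_self]
    congr 1
    refine Finset.prod_congr rfl fun k hk => ?_
    rw [Function.update_of_ne (by simpa using hk)]
  have hs : tensorVec b σ s = b (σ l) (s l) * ∏ k ∈ {l}ᶜ, b (σ k) (s k) := by
    rw [← hup, Function.update_eq_self]
  have hK := congrFun (h (σ l)) (s l)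
  rw [Matrix.mulVec, dotProduct, Pi.smul_apply, smul_eq_mul] at hK
  rw [siteOp_mulVec, Pi.smul_apply, smul_eq_mul, hs, ← mul_assoc, ← hK, Finset.sum_mul]
  exact Finset.sum_congr rfl fun a _ => by rw [hup, mul_assoc]

lemma tensorVec_ne_zero {b : Fin n → Fin n → ℂ} (hb : ∀ i, b i ≠ 0) (σ : Sites n N) :
    tensorVec b σ ≠ 0 := by
  choose t ht using fun i => Function.ne_iff.1 (hb i)
  refine Function.ne_iff.2 ⟨fun k => t (σ k), ?_⟩
  exact Finset.prod_ne_zero_iff.2 fun k _ => ht (σ k)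

/-- With `c l = x ^ l`, a coincidence between `σ ≠ τ` is a root of a nonzero polynomial in `x`, so
some `x` avoids them all. -/
lemma exists_weight_injective {d : Fin n → ℂ} (hd : Function.Injective d) :
    ∃ c : Fin N → ℂ, (∀ l, c l ≠ 0) ∧
      Function.Injective fun σ : Sites n N => ∑ l, c l * d (σ l) := by
  let p : Sites n N → Sites n N → Polynomial ℂ := fun σ τ =>
    ∑ l : Fin N, Polynomial.monomial (l : ℕ) (d (σ l) - d (τ l))
  have hp : ∀ σ τ, σ ≠ τ → p σ τ ≠ 0 := fun σ τ hne h0 => by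
    obtain ⟨l, hl⟩ := Function.ne_iff.1 hne
    have h1 := congrArg (fun q => Polynomial.coeff q l) h0
    simp only [p, Polynomial.finsetSum_coeff, Polynomial.coeff_monomial, Polynomial.coeff_zero,
      Fin.val_inj, Finset.sum_ite_eq', Finset.mem_univ, if_true] at h1
    exact hl (hd (sub_eq_zero.1 h1))
  -- The factor `X` forces `x ≠ 0`, hence nonzero weights.
  let q : Polynomial ℂ := Polynomial.X * ∏ στ : Sites n N × Sites n N,
    if στ.1 = στ.2 then 1 else p στ.1 στ.2
  have hq : q ≠ 0 := by
    refine mul_ne_zero Polynomial.X_ne_zero (Finset.prod_ne_zero_iff.2 fun στ _ => ?_)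
    split_ifs with h
    · exact one_ne_zero
    · exact hp _ _ h
  obtain ⟨x, hx⟩ : ∃ x, q.eval x ≠ 0 := by
    by_contra! hall
    exact hq (Polynomial.funext fun x => by simpa using hall x)
  rw [Polynomial.eval_mul, Polynomial.eval_X, Polynomial.eval_prod, mul_ne_zero_iff,
    Finset.prod_ne_zero_iff] at hx
  refine ⟨fun l => x ^ (l : ℕ), fun l => pow_ne_zero _ hx.1, fun σ τ h => ?_⟩
  by_contra hne
  have h2 := hx.2 (σ, τ) (Finset.mem_univ _)
  simp only [if_neg hne, p, Polynomial.eval_finsetSum, Polynomial.eval_monomial] at h2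
  refine h2 ?_
  simp only [sub_mul, Finset.sum_sub_distrib]
  rw [sub_eq_zero]
  simpa only [mul_comm] using h

lemma isDiagSimple_sum_siteOp {K : Matrix (Fin n) (Fin n) ℂ} (hK : IsDiagSimple K) :
    ∃ c : Fin N → ℂ, (∀ l, c l ≠ 0) ∧ IsDiagSimple (∑ l, c l • siteOp l K) := by
  obtain ⟨b, d, hd, h⟩ := hK
  obtain ⟨c, hc, hinj⟩ := exists_weight_injective (N := N) hd
  refine ⟨c, hc, isDiagSimple_of_eigenvectors (v := tensorVec b) hinj
    (tensorVec_ne_zero b.ne_zero) fun σ => ?_⟩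
  rw [Matrix.sum_mulVec, Finset.sum_smul]
  exact Finset.sum_congr rfl fun l _ => by
    rw [Matrix.smul_mulVec, siteOp_mulVec_tensorVec h, smul_smul]

lemma trace_map_mul_laxPerm (K : Matrix (Fin n) (Fin n) ℂ) (l : Fin N) :
    (K.map (algebraMap ℂ (Matrix (Sites n N) (Sites n N) ℂ)) * laxPerm l).trace = siteOp l K := by
  conv_rhs => rw [Matrix.matrix_eq_sum_single K]
  rw [Matrix.trace, map_sum]
  refine Finset.sum_congr rfl fun i _ => ?_
  rw [Matrix.diag_apply, Matrix.mul_apply, map_sum]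
  refine Finset.sum_congr rfl fun j _ => ?_
  rw [Matrix.map_apply, ← Algebra.smul_def, laxPerm, Matrix.of_apply, ← map_smul,
    Matrix.smul_single, smul_eq_mul, mul_one]

lemma trace_map_algebraMap {B : Type*} [Ring B] [Algebra ℂ B] (K : Matrix (Fin n) (Fin n) ℂ) :
    (K.map (algebraMap ℂ B)).trace = K.trace • (1 : B) := by
  rw [← Algebra.algebraMap_eq_smul_one]
  exact (AddMonoidHom.map_trace (algebraMap ℂ B) K).symm

/-- Second order expansion of the product of the factors `1 + ε a`. -/
lemma exists_prod_one_add_smul {A : Type*} [Ring A] [Algebra ℂ A] [TopologicalSpace A]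
    [IsTopologicalRing A] [ContinuousSMul ℂ A] (L : List A) :
    ∃ Q : ℂ → A, Continuous Q ∧
      ∀ ε : ℂ, (L.map fun a => 1 + ε • a).prod = 1 + ε • L.sum + ε ^ 2 • Q ε := by
  induction L with
  | nil => exact ⟨0, continuous_const, fun ε => by simp⟩
  | cons a L ih =>
    obtain ⟨Q, hQ, h⟩ := ih
    refine ⟨fun ε => Q ε + a * L.sum + ε • (a * Q ε), by fun_prop, fun ε => ?_⟩
    rw [List.map_cons, List.prod_cons, h, List.sum_cons]
    simp only [add_mul, mul_add, one_mul, mul_one, smul_mul_assoc, mul_smul_comm, smul_add,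
      smul_smul]
    module

lemma prod_map_smul {A ι : Type*} [Ring A] [Algebra ℂ A] (L : List ι) (f : ι → ℂ) (g : ι → A) :
    (L.map fun i => f i • g i).prod = (L.map f).prod • (L.map g).prod := by
  induction L with
  | nil => simp
  | cons a L ih => simp [ih, smul_smul, mul_comm]

lemma sum_map_reverse_finRange {A : Type*} [AddCommMonoid A] (f : Fin N → A) :
    ((List.finRange N).reverse.map f).sum = ∑ l, f l := by
  rw [List.map_reverse, List.sum_reverse, ← List.ofFn_eq_map, List.sum_ofFn]

/-- Expansion of the transfer matrix for large inhomogeneities. -/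
lemma exists_transferMatrix_expansion (K : Matrix (Fin n) (Fin n) ℂ) {c : Fin N → ℂ}
    (hc : ∀ l, c l ≠ 0) :
    ∃ Q : ℂ → Matrix (Sites n N) (Sites n N) ℂ, Continuous Q ∧ ∀ ε : ℂ, ε ≠ 0 →
      ∃ α : ℂ, α ≠ 0 ∧ transferMatrix K (fun l => -(ε * c l)⁻¹) 0 =
        α • (K.trace • 1 + ε • ∑ l, c l • siteOp l K + ε ^ 2 • Q ε) := by
  obtain ⟨Q, hQ, h⟩ := exists_prod_one_add_smul ((List.finRange N).reverse.map fun l =>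
    c l • laxPerm (n := n) l)
  have hQ' : Continuous fun ε =>
      K.map (algebraMap ℂ (Matrix (Sites n N) (Sites n N) ℂ)) * Q ε := continuous_const.mul hQ
  refine ⟨_, hQ'.matrix_trace, fun ε hε =>
    ⟨((List.finRange N).reverse.map fun l => (ε * c l)⁻¹).prod, ?_, ?_⟩⟩
  · refine List.prod_ne_zero fun h0 => ?_
    obtain ⟨l, -, hl⟩ := List.mem_map.1 h0
    exact inv_ne_zero (mul_ne_zero hε (hc l)) hl
  -- At this `ξ` the factor is `(ε c_l)⁻¹ + P`; pulling out the scalar leaves `1 + ε c_l P`, and `α`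
  -- collects the scalars.
  · have hlax : ∀ l : Fin N, lax (n := n) l (0 - -(ε * c l)⁻¹) =
        (ε * c l)⁻¹ • (1 + ε • (c l • laxPerm l)) := fun l => by
      rw [smul_add, smul_smul, smul_smul, mul_assoc,
        inv_mul_cancel₀ (mul_ne_zero hε (hc l)), one_smul, zero_sub, neg_neg, lax]
    have h' := h ε
    rw [List.map_map, sum_map_reverse_finRange, Function.comp_def] at h'
    rw [transferMatrix_eq_trace, List.map_congr_left fun l _ => hlax l, prod_map_smul,
      Matrix.mul_smul, Matrix.trace_smul]
    congr 1
    rw [h', mul_add, mul_add, mul_one, Matrix.trace_add, Matrix.trace_add, Matrix.mul_smul,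
      Matrix.mul_smul, Matrix.trace_smul, Matrix.trace_smul, trace_map_algebraMap,
      Finset.mul_sum, Matrix.trace_sum]
    congr 3
    exact Finset.sum_congr rfl fun l _ => by
      rw [Matrix.mul_smul, Matrix.trace_smul, trace_map_mul_laxPerm]

/-- Discarding the scalar matrix and the factor `α ε` leaves `S + ε Q(ε)`, whose discriminant is
continuous in `ε` and nonzero at `0`. -/
lemma exists_isDiagSimple_transferMatrix {K : Matrix (Fin n) (Fin n) ℂ} (hK : IsDiagSimple K) :
    ∃ ξ : Fin N → ℂ, IsDiagSimple (transferMatrix K ξ 0) := by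
  obtain ⟨c, hc, hS⟩ := isDiagSimple_sum_siteOp (N := N) hK
  obtain ⟨Q, hQ, h⟩ := exists_transferMatrix_expansion K hc
  set S := ∑ l, c l • siteOp l K with hSdef
  have hcont : Continuous fun ε : ℂ => specDisc (S + ε • Q ε) :=
    continuous_specDisc.comp (continuous_const.add (continuous_id.smul hQ))
  have h0 : specDisc (S + (0 : ℂ) • Q 0) ≠ 0 := by
    rw [zero_smul, add_zero]
    exact (specDisc_ne_zero_iff S).2 hS
  have hev : ∀ᶠ ε in nhdsWithin (0 : ℂ) {0}ᶜ, specDisc (S + ε • Q ε) ≠ 0 ∧ ε ≠ 0 :=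
    ((hcont.continuousAt.eventually_ne h0).filter_mono nhdsWithin_le_nhds).and
      self_mem_nhdsWithin
  obtain ⟨ε, hε, hε0⟩ := hev.exists
  obtain ⟨α, hα, hT⟩ := h ε hε0
  refine ⟨_, ((specDisc_ne_zero_iff _).1 hε).smul_add (mul_ne_zero hα hε0) (α * K.trace)
    (hT.trans ?_)⟩
  module

end Generic

/-! ### Polynomial dependence on the inhomogeneities -/

section Polynomial

variable {n N : ℕ}

/-- The transfer matrix at `z = 0` is polynomial in the inhomogeneities. -/
lemma exists_polynomial_transferMatrix (K : Matrix (Fin n) (Fin n) ℂ) :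
    ∃ P : Matrix (Sites n N) (Sites n N) (MvPolynomial (Fin N) ℂ),
      ∀ ξ, P.map (MvPolynomial.eval ξ) = transferMatrix K ξ 0 := by
  let R := MvPolynomial (Fin N) ℂ
  let lift : Matrix (Fin n) (Fin n) (Matrix (Sites n N) (Sites n N) ℂ) →+*
      Matrix (Fin n) (Fin n) (Matrix (Sites n N) (Sites n N) R) :=
    (MvPolynomial.C.mapMatrix).mapMatrix
  let ev : (Fin N → ℂ) → (Matrix (Fin n) (Fin n) (Matrix (Sites n N) (Sites n N) R) →+*
      Matrix (Fin n) (Fin n) (Matrix (Sites n N) (Sites n N) ℂ)) :=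
    fun ξ => ((MvPolynomial.eval ξ).mapMatrix).mapMatrix
  have hlift : ∀ ξ M, ev ξ (lift M) = M := fun ξ M => by
    ext i j s t
    simp [ev, lift]
  have hX : ∀ ξ l, ev ξ (Matrix.scalar _ (Matrix.scalar _ (-(MvPolynomial.X l : R)))) =
      (0 - ξ l) • 1 := fun ξ l => by
    ext i j s t
    by_cases hij : i = j <;> by_cases hst : s = t <;>
      simp [ev, hij, hst]
  -- The monodromy matrix at `z = 0`, with variables in place of the `ξ_l`.
  let M := lift (K.map (algebraMap ℂ (Matrix (Sites n N) (Sites n N) ℂ))) *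
    ((List.finRange N).reverse.map fun l =>
      Matrix.scalar _ (Matrix.scalar _ (-(MvPolynomial.X l : R))) + lift (laxPerm l)).prod
  refine ⟨M.trace, fun ξ => ?_⟩
  have h1 : ev ξ M = K.map (algebraMap ℂ (Matrix (Sites n N) (Sites n N) ℂ)) *
      ((List.finRange N).reverse.map fun l => lax l (0 - ξ l)).prod := by
    rw [map_mul, hlift, map_list_prod, List.map_map]
    congr 3
    funext l
    rw [Function.comp_apply, map_add, hlift, hX, lax]
  rw [transferMatrix_eq_trace, ← h1]
  exact AddMonoidHom.map_trace (MvPolynomial.eval ξ).mapMatrix M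

lemma transferMatrix_shift (K : Matrix (Fin n) (Fin n) ℂ) (ξ : Fin N → ℂ) (z : ℂ) :
    transferMatrix K ξ z = transferMatrix K (fun l => ξ l - z) 0 := by
  simp only [transferMatrix, monodromy, zero_sub, neg_sub]

/-- Restricted to this line, `p` becomes a one-variable polynomial, nonzero because its value at `z
= 0` is. -/
lemma finite_setOf_eval_sub_eq_zero {p : MvPolynomial (Fin N) ℂ} {ξ : Fin N → ℂ}
    (h : MvPolynomial.eval ξ p ≠ 0) :
    {z : ℂ | MvPolynomial.eval (fun l => ξ l - z) p = 0}.Finite := by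
  let q : Polynomial ℂ :=
    MvPolynomial.aeval (fun l => Polynomial.C (ξ l) - Polynomial.X) p
  have hq : ∀ z, q.eval z = MvPolynomial.eval (fun l => ξ l - z) p := fun z => by
    have := MvPolynomial.map_aeval (fun l => Polynomial.C (ξ l) - Polynomial.X)
      (Polynomial.evalRingHom z) p
    rw [Polynomial.coe_evalRingHom] at this
    rw [this, MvPolynomial.eval]
    congr 2
    · ext; simp
    · funext l; simp
  have hq0 : q ≠ 0 := fun h0 => h (by simpa [h0] using (hq 0).symm)
  refine (q.finite_setOfPred_isRoot hq0).subset fun z hz => ?_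
  rw [Set.mem_ofPred_eq, Polynomial.IsRoot, hq]
  exact hz

end Polynomial

end YangianGln

end

/-! ### The main theorem -/

theorem mainTheorem6 (n N : ℕ) (K : Matrix (Fin n) (Fin n) ℂ)
    (hK : YangianGln.IsDiagSimple K) :
    YangianGln.ForAlmostAll fun ξ : Fin N → ℂ =>
      (∀ t : ℂ → ℂ, YangianGln.IsEigenvalue (YangianGln.transferMatrix K ξ) t →
        (∃ v, YangianGln.IsEigenvector (YangianGln.transferMatrix K ξ) t v ∧
          ∀ v', YangianGln.IsEigenvector (YangianGln.transferMatrix K ξ) t v' →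
            ∃ c : ℂ, v' = c • v) ∧
        (∃ w, YangianGln.IsEigencovector (YangianGln.transferMatrix K ξ) t w ∧
          ∀ w', YangianGln.IsEigencovector (YangianGln.transferMatrix K ξ) t w' →
            ∃ c : ℂ, w' = c • w) ∧
        ∀ v w, YangianGln.IsEigenvector (YangianGln.transferMatrix K ξ) t v →
          YangianGln.IsEigencovector (YangianGln.transferMatrix K ξ) t w → w ⬝ᵥ v ≠ 0) ∧
      YangianGln.IsDiagSimpleFamily (YangianGln.transferMatrix K ξ) ∧
      {z : ℂ | ¬ YangianGln.IsDiagSimple (YangianGln.transferMatrix K ξ z)}.Finite := by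
  obtain ⟨P, hP⟩ := YangianGln.exists_polynomial_transferMatrix (N := N) K
  obtain ⟨ξ₀, hξ₀⟩ := YangianGln.exists_isDiagSimple_transferMatrix (N := N) hK
  have hdisc : ∀ ξ, MvPolynomial.eval ξ (YangianGln.specDisc P) ≠ 0 ↔
      YangianGln.IsDiagSimple (YangianGln.transferMatrix K ξ 0) := fun ξ => by
    rw [← YangianGln.specDisc_ne_zero_iff, ← hP, YangianGln.specDisc_map]
  -- The exceptional polynomial is the discriminant; the single good point `ξ₀` shows that it is not
  -- identically zero.
  refine ⟨YangianGln.specDisc P, fun h0 => (hdisc ξ₀).2 hξ₀ (by rw [h0, map_zero]),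
    fun ξ hξ => ?_⟩
  have hfam : YangianGln.IsDiagSimpleFamily (YangianGln.transferMatrix K ξ) :=
    .of_commute ((hdisc ξ).1 hξ) (YangianGln.transferMatrix_commute K ξ 0)
  refine ⟨fun t ht => hfam.eigenvalue ht, hfam,
    (YangianGln.finite_setOf_eval_sub_eq_zero hξ).subset fun z hz => ?_⟩
  rw [Set.mem_ofPred_eq, YangianGln.transferMatrix_shift, ← hdisc, not_not] at hz
  exact hz
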